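/- **Setting.** For every $n\in\mathbb N$ let $A_n\subseteq \mathbb Z/(2n+1)\mathbb Z$ be an arbitrary subset. Extend the first-order language of groups by a unary predicate symbol $A$ and by the following formulas (which may be nested): whenever $\alpha_1,\dots,\alpha_k,\gamma$ are rationals, $\vec x$ is a tuple of variables and $B_1(\vec x,\vec y_1),\dots,B_k(\vec x,\vec y_k)$ are formulas, $\int\sum_{i\le k}\alpha_i B_i\,dm(\vec x)>\gamma$ is a formula with free variables $\vec y_1,\dots,\vec y_k$. In the finite structure $G_n=(\mathbb Z/(2n+1)\mathbb Z,+,A_n)$ it holds at $(\vec p_1,\dots,\vec p_k)$ if and only if $$\sum_{i\le k}\alpha_i\,\frac{|\{\vec x : G_n\models B_i(\vec x,\vec p_i)\}|}{(2n+1)^{|\vec x|}}>\gamma .$$ Let $U$ be a nonprincipal ultrafilter on $\{n : 2n+1\text{ is prime}\}$ and let $(G,+,A)$ be the ultraproduct of the $G_n$ along $U$, in which an integral formula is treated as a relation symbol and holds at a tuple if and only if it holds in $U$-almost every factor at the coordinates of the tuple. For $d\ge 0$ let $\mu^d$ be the Loeb measure on $G^d$: the restriction, to the $\sigma$-algebra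 generated by the internal subsets of $G^d$, of the Carathéodory extension of $\prod_U S_n\mapsto \lim_U |S_n|/(2n+1)^d$. A *formula with parameters* in the variables $\vec x=(x_1,\dots,x_d)$ is a pair consisting of a formula $\phi(\vec x,\vec y)$ of the extended language and a tuple $\vec a$ from $G$ with $|\vec a|=|\vec y|$; it is written $\phi(\vec x,\vec a)$ and defines the set $\{\vec x\in G^d : G\models\phi(\vec x,\vec a)\}$. A *Boolean algebra of formulas* is a set $\mathcal B$ of formulas with parameters such that the sets defined by its members form a Boolean algebra of subsets of $G^d$. As formulas are identified with the sets they define, inclusions between such algebras, and membership of $\phi(\vec x,\vec b)$ in $\mathcal B$ in condition 2 below, refer to the sets defined. Let $\mathcal B^\sigma$ be the $\sigma$-algebra on $G^d$ generated by the sets defined by members of $\mathcal B$. A substructure $M$ of $G$ (with the integral formulas inherited from $G$ as relations) is an *elementary submodel* if every formula of the extended language has the same truth value in $M$ and in $G$ at every tuple from $M$. **Lemma.** Let $\mathcal B,\mathcal B_0,\mathcal B_1$ be Boolean algebras of formulas in $d$ variables with $\mathcal B\subseteq\mathcal B_0\cap\mathcal B_1$. Suppose there is an elementary submodel $M$ of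 $G$ such that: 1. every parameter of every formula in $\mathcal B_1$ belongs to $M$; 2. if $\phi(\vec x,\vec a)$ is a formula in $\mathcal B_0$ and $\vec b$ is a tuple from $M$ with $|\vec b|=|\vec a|$, then $\phi(\vec x,\vec b)\in\mathcal B$. Then for every real-valued $f\in L^2(\mathcal B_1^\sigma)$, with respect to $\mu^d$, $$\bigl\|E(f\mid\mathcal B^\sigma)-E(f\mid\mathcal B_0^\sigma)\bigr\|_{L^2(\mu^d)}=0 .$$ -/

import Mathlib

open FirstOrder Filter MeasureTheory
open scoped ENNReal

namespace IntLogic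

universe u v w w'

/-! ## First-order logic with measure-comparison formulas -/

/-- Formulas over a language `L` whose free variables are indexed by `Fin n`.  They are the
first-order formulas together with, for rationals `α₁, …, αₖ, γ` and formulas `B₁, …, Bₖ`, the
formula `∫ ∑ᵢ αᵢ Bᵢ dm(x) > γ`, in which a tuple `x` of `j` variables is bound: these are the last
`j` of the `n + j` variables of each `Bᵢ`.  Such formulas may be nested. -/
inductive Fml (L : FirstOrder.Language.{u, v}) : ℕ → Type (max u v)
  | falsum {n : ℕ} : Fml L n
  | equal {n : ℕ} (t s : L.Term (Fin n)) : Fml L n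
  | rel {n l : ℕ} (R : L.Relations l) (ts : Fin l → L.Term (Fin n)) : Fml L n
  | imp {n : ℕ} (φ ψ : Fml L n) : Fml L n
  | all {n : ℕ} (φ : Fml L (n + 1)) : Fml L n
  | integral {n : ℕ} (j k : ℕ) (α : Fin k → ℚ) (B : Fin k → Fml L (n + j)) (γ : ℚ) : Fml L n

/-- Truth in a finite structure: `∫ ∑ᵢ αᵢ Bᵢ dm(x) > γ` holds at `p` when
`∑ᵢ αᵢ |{x | Bᵢ(p, x)}| / |X|^j > γ`, with `j` the length of `x`. -/
noncomputable def Fml.FinRealize {L : FirstOrder.Language.{u, v}} {X : Type w} [L.Structure X] :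
    {n : ℕ} → Fml L n → (Fin n → X) → Prop
  | _, .falsum, _ => False
  | _, .equal t s, p => t.realize p = s.realize p
  | _, .rel R ts, p => Language.Structure.RelMap R fun i => (ts i).realize p
  | _, .imp φ ψ, p => φ.FinRealize p → ψ.FinRealize p
  | _, .all φ, p => ∀ x : X, φ.FinRealize (Fin.snoc p x : Fin _ → X)
  | _, .integral j _ α B γ, p =>
      γ < ∑ i, α i * ((Set.ncard {x : Fin j → X | (B i).FinRealize (Fin.append p x)} : ℚ) /
        (Nat.card X : ℚ) ^ j)

/-- An interpretation, in a possibly infinite structure `X`, of the formulas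
`∫ ∑ᵢ αᵢ Bᵢ dm(x) > γ`, which are treated there like relation symbols. -/
abbrev IntegralInterp (L : FirstOrder.Language.{u, v}) (X : Type w) : Type (max u v w) :=
  ∀ (n j k : ℕ), (Fin k → ℚ) → (Fin k → Fml L (n + j)) → ℚ → (Fin n → X) → Prop

/-- Truth in a structure in which the integral formulas are interpreted by `I`. -/
def Fml.Realize {L : FirstOrder.Language.{u, v}} {X : Type w} [L.Structure X] (I : IntegralInterp L X) :
    {n : ℕ} → Fml L n → (Fin n → X) → Prop
  | _, .falsum, _ => False
  | _, .equal t s, p => t.realize p = s.realize p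
  | _, .rel R ts, p => Language.Structure.RelMap R fun i => (ts i).realize p
  | _, .imp φ ψ, p => φ.Realize I p → ψ.Realize I p
  | _, .all φ, p => ∀ x : X, φ.Realize I (Fin.snoc p x : Fin _ → X)
  | _, .integral j k α B γ, p => I _ j k α B γ p

/-- A substructure `M` of `X`, with the integral formulas inherited from `X` as relations, is
elementary when every formula (including integral formulas) has in `M` and in `X` the same truth
value at each tuple of `M`. -/
def IsElementary {L : FirstOrder.Language.{u, v}} {X : Type w} [L.Structure X] (I : IntegralInterp L X)
    (M : L.Substructure X) : Prop :=
  ∀ ⦃n : ℕ⦄ (φ : Fml L n) (p : Fin n → M),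
    φ.Realize (X := M) (fun n j k α B γ q => I n j k α B γ fun i => (q i : X)) p ↔
      φ.Realize I fun i => (p i : X)

/-! ## Ultraproducts of finite structures and Loeb measure -/

section Ultraproduct

variable {ι : Type w} (U : Ultrafilter ι) (G : ι → Type w')

/-- The ultraproduct of the family `G` along `U`; it carries Mathlib's `L`-structure. -/
abbrev UProd : Type (max w w') := (U : Filter ι).Product G

/-- The `i`-th coordinates of representatives of the entries of a tuple of the ultraproduct. -/
noncomputable def coord {U : Ultrafilter ι} {G : ι → Type w'} {n : ℕ} (p : Fin n → UProd U G)
    (i : ι) : Fin n → G i :=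
  fun j => (Quotient.out (p j) : ∀ i, G i) i

/-- In the ultraproduct, `∫ ∑ᵢ αᵢ Bᵢ dm(x) > γ` holds when it holds in almost every factor. -/
def ultraInterp (L : FirstOrder.Language.{u, v}) [∀ i, L.Structure (G i)] : IntegralInterp L (UProd U G) :=
  fun _ j k α B γ p => ∀ᶠ i in (U : Filter ι), (Fml.integral j k α B γ).FinRealize (coord p i)

variable {G}

theorem coord_coe {n : ℕ} (r : Fin n → ∀ i, G i) :
    ∀ᶠ i in (U : Filter ι), coord (fun j => (r j : UProd U G)) i = fun j => r j i := by
  have h : ∀ j, ∀ᶠ i in (U : Filter ι),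
      (Quotient.out (r j : UProd U G) : ∀ i, G i) i = r j i := fun j =>
    Quotient.exact (Quotient.out_eq (r j : UProd U G))
  filter_upwards [eventually_all.2 h] with i hi
  exact funext hi

/-- **Łoś's theorem** for the extended formulas. -/
theorem realize_coe {L : FirstOrder.Language.{u, v}} [∀ i, L.Structure (G i)] [∀ i, Nonempty (G i)] {n : ℕ}
    (φ : Fml L n) (r : Fin n → ∀ i, G i) :
    φ.Realize (ultraInterp U G L) (fun j => (r j : UProd U G)) ↔
      ∀ᶠ i in (U : Filter ι), φ.FinRealize fun j => r j i := by
  induction φ with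
  | falsum => simp only [Fml.Realize, Fml.FinRealize, eventually_const]
  | equal t s =>
    simp only [Fml.Realize, Fml.FinRealize]
    erw [Language.Ultraproduct.term_realize_cast, Language.Ultraproduct.term_realize_cast]
    exact Quotient.eq''
  | rel R ts =>
    simp only [Fml.Realize, Fml.FinRealize]
    conv_lhs => enter [2, i]; erw [Language.Ultraproduct.term_realize_cast]
    apply Language.relMap_quotient_mk'
  | imp φ ψ ih ih' =>
    simp only [Fml.Realize, Fml.FinRealize, ih, ih', Ultrafilter.eventually_imp]
  | @all k φ ih =>
    have key : ∀ m : ∀ i, G i,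
        φ.Realize (ultraInterp U G L)
          (Fin.snoc (fun j => (r j : UProd U G)) (m : UProd U G) : Fin (k + 1) → UProd U G) ↔
        ∀ᶠ i in (U : Filter ι), φ.FinRealize (Fin.snoc (fun j => r j i) (m i) : Fin _ → G i) := by
      intro m
      have e1 : (Fin.snoc (fun j => (r j : UProd U G)) (m : UProd U G) : Fin (k + 1) → UProd U G) =
          fun j => ((Fin.snoc r m : Fin (k + 1) → ∀ i, G i) j : UProd U G) := by
        funext j
        refine Fin.lastCases ?_ (fun j => ?_) j
        · rw [Fin.snoc_last (α := fun _ => ∀ i, G i)]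
          exact Fin.snoc_last (α := fun _ => UProd U G) _ _
        · rw [Fin.snoc_castSucc (α := fun _ => ∀ i, G i)]
          exact Fin.snoc_castSucc (α := fun _ => UProd U G) _ _ _
      have e2 : ∀ i, (Fin.snoc (fun j => r j i) (m i) : Fin (k + 1) → G i) =
          fun j => (Fin.snoc r m : Fin (k + 1) → ∀ i, G i) j i := by
        intro i
        funext j
        refine Fin.lastCases ?_ (fun j => ?_) j <;> simp
      rw [e1, ih]
      simp only [e2]
    simp only [Fml.Realize, Fml.FinRealize]
    refine Iff.trans Quotient.forall ?_
    refine ⟨fun h => ?_, fun h m => ?_⟩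
    · by_contra hc
      rw [← Ultrafilter.eventually_not] at hc
      refine (Ultrafilter.eventually_not.1 ?_)
        ((key fun i => Classical.epsilon fun x : G i =>
          ¬ φ.FinRealize (Fin.snoc (fun j => r j i) x : Fin _ → G i)).1 (h _))
      filter_upwards [hc] with i hi
      exact Classical.epsilon_spec (not_forall.1 hi)
    · exact (key m).2 (h.mono fun i hi => hi (m i))
  | integral j k α B γ _ =>
    simp only [Fml.Realize, ultraInterp]
    refine eventually_congr ?_
    filter_upwards [coord_coe U r] with i hi
    rw [hi]

/-- The internal subset of the `n`-th power of the ultraproduct given by sets `S i ⊆ (G i)ⁿ`. -/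
def internalSet {n : ℕ} (S : ∀ i, Set (Fin n → G i)) : Set (Fin n → UProd U G) :=
  {p | ∀ᶠ i in (U : Filter ι), coord p i ∈ S i}

/-- The standard part of the normalized internal counting measure `|S i| / |G i|ⁿ`, that is, its
limit along the ultrafilter. -/
noncomputable def internalCount {n : ℕ} (S : ∀ i, Set (Fin n → G i)) : ℝ≥0∞ :=
  (U.map fun i => ((S i).ncard : ℝ≥0∞) / (Nat.card (G i) : ℝ≥0∞) ^ n).lim

theorem tendsto_internalCount {n : ℕ} (S : ∀ i, Set (Fin n → G i)) :
    Tendsto (fun i => ((S i).ncard : ℝ≥0∞) / (Nat.card (G i) : ℝ≥0∞) ^ n) (U : Filter ι)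
      (nhds (internalCount U S)) :=
  Ultrafilter.le_nhds_lim (U.map fun i => ((S i).ncard : ℝ≥0∞) / (Nat.card (G i) : ℝ≥0∞) ^ n)

/-- The set function `internalSet U S ↦ internalCount U S`, with value `∞` off the internal sets. -/
noncomputable def internalContent {n : ℕ} (s : Set (Fin n → UProd U G)) : ℝ≥0∞ :=
  ⨅ (S : ∀ i, Set (Fin n → G i)) (_ : s = internalSet U S), internalCount U S

theorem internalContent_empty {n : ℕ} :
    internalContent U (∅ : Set (Fin n → UProd U G)) = 0 := by
  have h0 : internalCount U (fun i => (∅ : Set (Fin n → G i))) = 0 :=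
    tendsto_nhds_unique (tendsto_internalCount U _) (by simp)
  refine le_antisymm (h0 ▸ iInf₂_le (fun i => (∅ : Set (Fin n → G i))) ?_) bot_le
  ext p
  simp only [internalSet, Set.mem_empty_iff_false, Set.mem_ofPred_eq, eventually_const]

variable (G)

/-- The σ-algebra on the `n`-th power of the ultraproduct generated by the internal sets. -/
@[reducible] def loebSpace (n : ℕ) : MeasurableSpace (Fin n → UProd U G) :=
  MeasurableSpace.generateFrom (Set.range (internalSet U))

theorem loebSpace_le_caratheodory [∀ i, Finite (G i)] (n : ℕ) :
    loebSpace U G n ≤ (OuterMeasure.ofFunction (internalContent U)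
      (internalContent_empty (G := G) (n := n) U)).caratheodory := by
  refine MeasurableSpace.generateFrom_le ?_
  rintro _ ⟨S, rfl⟩
  refine OuterMeasure.ofFunction_caratheodory fun t => ?_
  refine le_iInf₂ fun T hT => ?_
  have h1 : t ∩ internalSet U S = internalSet U fun i => T i ∩ S i := by
    ext p
    simp [hT, internalSet, eventually_and]
  have h2 : t \ internalSet U S = internalSet U fun i => T i \ S i := by
    ext p
    simp [hT, internalSet, eventually_and]
  have h3 : internalCount U (fun i => T i ∩ S i) + internalCount U (fun i => T i \ S i) =
      internalCount U T := by
    refine tendsto_nhds_unique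
      ((tendsto_internalCount U _).add (tendsto_internalCount U _)) ?_
    refine (tendsto_internalCount U T).congr fun i => ?_
    rw [← ENNReal.add_div, ← Nat.cast_add, Set.ncard_inter_add_ncard_sdiff_eq_ncard]
  rw [← h3]
  refine add_le_add ?_ ?_
  · exact iInf₂_le (fun i => T i ∩ S i) h1
  · exact iInf₂_le (fun i => T i \ S i) h2

/-- The Loeb measure on the `n`-th power of the ultraproduct: the Carathéodory extension of the
standard part of the normalized internal counting measure. -/
noncomputable def loebMeasure [∀ i, Finite (G i)] (n : ℕ) :
    @Measure (Fin n → UProd U G) (loebSpace U G n) :=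
  @OuterMeasure.toMeasure _ (loebSpace U G n)
    (OuterMeasure.ofFunction (internalContent U) (internalContent_empty U))
    (loebSpace_le_caratheodory U G n)

/-! ## Boolean algebras of formulas with parameters -/

/-- A formula `φ(x, a)` in the variables `x = (x₁, …, xₙ)` with a parameter tuple `a`. -/
structure ParamFml (L : FirstOrder.Language.{u, v}) (X : Type w) (n : ℕ) where
  /-- The length of the parameter tuple. -/
  len : ℕ
  /-- The formula `φ(x, y)`. -/
  fml : Fml L (n + len)
  /-- The parameter tuple `a`. -/
  param : Fin len → X

/-- The set of all `x` such that `φ(x, a)` holds. -/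
def ParamFml.toSet {L : FirstOrder.Language.{u, v}} {X : Type w} [L.Structure X] (I : IntegralInterp L X)
    {n : ℕ} (θ : ParamFml L X n) : Set (Fin n → X) :=
  {x | θ.fml.Realize I (Fin.append x θ.param)}

/-- A Boolean algebra of formulas with parameters.  Formulas are identified with the sets they
define, so closure under the Boolean operations is required up to equivalence of formulas. -/
structure FmlAlgebra {L : FirstOrder.Language.{u, v}} {X : Type w} [L.Structure X] (I : IntegralInterp L X)
    (n : ℕ) where
  /-- The formulas of the algebra, with their parameters. -/
  formulas : Set (ParamFml L X n)
  isSetAlgebra : IsSetAlgebra (ParamFml.toSet I '' formulas)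

/-- The sets defined by the formulas of a Boolean algebra of formulas. -/
def FmlAlgebra.sets {L : FirstOrder.Language.{u, v}} {X : Type w} [L.Structure X] {I : IntegralInterp L X}
    {n : ℕ} (𝓑 : FmlAlgebra I n) : Set (Set (Fin n → X)) :=
  ParamFml.toSet I '' 𝓑.formulas

/-- The σ-algebra generated by a Boolean algebra of formulas. -/
@[reducible] def FmlAlgebra.sigma {L : FirstOrder.Language.{u, v}} {X : Type w} [L.Structure X] {I : IntegralInterp L X}
    {n : ℕ} (𝓑 : FmlAlgebra I n) : MeasurableSpace (Fin n → X) :=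
  MeasurableSpace.generateFrom 𝓑.sets

/-- Definable sets are internal, so conditional expectations on `𝓑.sigma` make sense for the Loeb
measure. -/
theorem FmlAlgebra.sigma_le {L : FirstOrder.Language.{u, v}} [∀ i, L.Structure (G i)] [∀ i, Nonempty (G i)]
    {n : ℕ} (𝓑 : FmlAlgebra (ultraInterp U G L) n) : 𝓑.sigma ≤ loebSpace U G n := by
  refine MeasurableSpace.generateFrom_le ?_
  rintro _ ⟨θ, -, rfl⟩
  refine MeasurableSpace.measurableSet_generateFrom
    ⟨fun i => {x | θ.fml.FinRealize (Fin.append x (coord θ.param i))}, ?_⟩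
  ext p
  have e : Fin.append p θ.param = fun j =>
      ((Fin.append (fun j => Quotient.out (p j)) (fun j => Quotient.out (θ.param j)) :
        Fin (n + θ.len) → ∀ i, G i) j : UProd U G) := by
    funext j
    refine Fin.addCases (fun j => ?_) (fun j => ?_) j
    · simp only [Fin.append_left]; exact (Quotient.out_eq _).symm
    · simp only [Fin.append_right]; exact (Quotient.out_eq _).symm
  have e2 : ∀ i, Fin.append (coord p i) (coord θ.param i) = fun j =>
      (Fin.append (fun j => Quotient.out (p j)) (fun j => Quotient.out (θ.param j)) :
        Fin (n + θ.len) → ∀ i, G i) j i := by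
    intro i
    funext j
    refine Fin.addCases (fun j => ?_) (fun j => ?_) j
    · simp only [Fin.append_left]; rfl
    · simp only [Fin.append_right]; rfl
  simp only [internalSet, ParamFml.toSet, Set.mem_ofPred_eq]
  rw [e, realize_coe]
  simp only [e2]

end Ultraproduct

/-! ## The cyclic groups of odd prime order with a distinguished subset -/

/-- Function symbols of the language of (additive) groups. -/
inductive GroupFun : ℕ → Type
  | zero : GroupFun 0
  | neg : GroupFun 1
  | add : GroupFun 2

/-- The unary predicate symbol `A`. -/
inductive PredSymb : ℕ → Type
  | mem : PredSymb 1

/-- The language of groups extended by a unary predicate symbol `A`. -/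
def groupPred : FirstOrder.Language := ⟨GroupFun, PredSymb⟩

/-- The indices `n` for which `2n + 1` is prime. -/
abbrev PrimeIdx : Type := {n : ℕ // (2 * n + 1).Prime}

/-- The group of integers modulo `2n + 1`, for `2n + 1` prime, with the distinguished subset
`A n`. -/
def Cyc (_ : ∀ n : ℕ, Set (ZMod (2 * n + 1))) (n : PrimeIdx) : Type := ZMod (2 * n.1 + 1)

section Cyc

variable (A : ∀ n : ℕ, Set (ZMod (2 * n + 1))) (n : PrimeIdx)

instance : AddCommGroup (Cyc A n) := inferInstanceAs (AddCommGroup (ZMod (2 * n.1 + 1)))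

instance : Finite (Cyc A n) := inferInstanceAs (Finite (ZMod (2 * n.1 + 1)))

instance : groupPred.Structure (Cyc A n) where
  funMap
    | .zero, _ => 0
    | .neg, x => - x 0
    | .add, x => x 0 + x 1
  RelMap
    | .mem, x => (x 0 : ZMod (2 * n.1 + 1)) ∈ A n.1

end Cyc

/-- The ultraproduct `(G, +, A)` along `U` of the structures `(ℤ/(2n+1)ℤ, +, A n)`, over those `n`
for which `2n + 1` is prime. -/
abbrev UGroup (A : ∀ n : ℕ, Set (ZMod (2 * n + 1))) (U : Ultrafilter PrimeIdx) : Type :=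
  UProd U (Cyc A)

/-- The interpretation of the integral formulas in `(G, +, A)`. -/
abbrev ugroupInterp (A : ∀ n : ℕ, Set (ZMod (2 * n + 1))) (U : Ultrafilter PrimeIdx) :
    IntegralInterp groupPred (UGroup A U) :=
  ultraInterp U (Cyc A) groupPred

end IntLogic

open IntLogic

namespace IntLogic

universe u v w w'

/-! Put `h = E(f | 𝓑^σ)` and `g = f - h`. Since `𝓑 ⊆ 𝓑₁`, `g` is `𝓑₁^σ`-measurable, and its integral
over every set of `𝓑^σ` vanishes. It is enough that `∫_D g = 0` for each `D = φ(x, a)` in `𝓑₀`: then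
`h`, being `𝓑₀^σ`-measurable, is also `E(f | 𝓑₀^σ)`.

Suppose `∫_D g > 0`. Approximate `g` in `L¹` by a rational combination `∑ βⱼ 1_{Hⱼ}` with `Hⱼ ∈ 𝓑₁`
(`exists_rat_combination`). Then `∑ βⱼ μ(Hⱼ ∩ φ(x, a)) > γ` for some rational `γ` exceeding the
approximation error. Up to passing to the limit, this is an integral formula in `a` whose other
parameters lie in `M`, so elementarity yields `b` in `M` with `∑ βⱼ μ(Hⱼ ∩ φ(x, b)) ≥ γ`
(`exists_param_le_sum_loebMeasure`). Hence `∫ g > 0` over `φ(x, b)`, a set of `𝓑`, which is a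
contradiction. Complements handle negative integrals. `condExp_ae_eq_of_realizable` isolates the
measure theory; `loebMeasure_internalSet` connects Loeb measure with counting in the factors. -/

/-! ### Measure theory: approximation by an algebra of sets and conditional expectation. -/

/-- An integrable function measurable with respect to the σ-algebra generated by an algebra `S` of
sets is approximated, uniformly in its integrals over measurable sets, by rational combinations of
indicators of members of `S`. -/
theorem exists_rat_combination {Ω : Type*} {m0 : MeasurableSpace Ω} (μ : Measure Ω)
    [IsFiniteMeasure μ] {S : Set (Set Ω)} (hS : IsSetAlgebra S)
    (hm : MeasurableSpace.generateFrom S ≤ m0) {g : Ω → ℝ}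
    (hg : AEStronglyMeasurable[MeasurableSpace.generateFrom S] g μ) (hgi : Integrable g μ)
    {ε : ℝ} (hε : 0 < ε) :
    ∃ (k : ℕ) (H : Fin k → Set Ω) (β : Fin k → ℚ), (∀ j, H j ∈ S) ∧
      ∀ D, MeasurableSet D → |∫ x in D, g x ∂μ - ∑ j, (β j : ℝ) * μ.real (H j ∩ D)| ≤ ε := by
  -- The bound is uniform in `D`, and `ε` is quantified inside `P`, so `P` survives `L¹` limits:
  -- integrals over any `D` differ by at most the `L¹` distance.
  let P : (Ω → ℝ) → Prop := fun g => ∀ ε : ℝ, 0 < ε →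
    ∃ (k : ℕ) (H : Fin k → Set Ω) (β : Fin k → ℚ), (∀ j, H j ∈ S) ∧
      ∀ D, MeasurableSet D → |∫ x in D, g x ∂μ - ∑ j, (β j : ℝ) * μ.real (H j ∩ D)| ≤ ε
  have hcongr : ∀ {f g : Ω → ℝ}, f =ᵐ[μ] g → P f → P g := by
    intro f g hfg hf ε hε
    obtain ⟨k, H, β, hH, h⟩ := hf ε hε
    refine ⟨k, H, β, hH, fun D hD => ?_⟩
    rw [← setIntegral_congr_ae hD (hfg.mono fun x hx _ => hx)]
    exact h D hD
  have hlim : ∀ f : Ω → ℝ, Integrable f μ → (∀ δ : ℝ, 0 < δ → ∃ g, P g ∧ Integrable g μ ∧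
      ∫ x, ‖f x - g x‖ ∂μ ≤ δ) → P f := by
    intro f hf h ε hε
    obtain ⟨g, hg, hgi, hfg⟩ := h (ε / 2) (half_pos hε)
    obtain ⟨k, H, β, hH, h⟩ := hg (ε / 2) (half_pos hε)
    refine ⟨k, H, β, hH, fun D hD => ?_⟩
    have h1 : |∫ x in D, f x ∂μ - ∫ x in D, g x ∂μ| ≤ ε / 2 := by
      rw [← integral_sub hf.integrableOn hgi.integrableOn, ← Real.norm_eq_abs]
      refine (norm_integral_le_integral_norm _).trans (le_trans ?_ hfg)
      exact setIntegral_le_integral (hf.sub hgi).norm (ae_of_all _ fun x => norm_nonneg _)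
    calc _ ≤ |∫ x in D, f x ∂μ - ∫ x in D, g x ∂μ| +
          |∫ x in D, g x ∂μ - ∑ j, (β j : ℝ) * μ.real (H j ∩ D)| := abs_sub_le _ _ _
      _ ≤ ε := by linarith [h D hD]
  have hdense := Measure.MeasureDense.of_generateFrom_isSetAlgebra_finite
    (m := MeasurableSpace.generateFrom S) (𝒜 := S) (μ.trim hm) hS rfl
  have hind : ∀ (c : ℝ) ⦃s : Set Ω⦄, MeasurableSet[MeasurableSpace.generateFrom S] s →
      P (s.indicator fun _ => c) := by
    intro c s hs ε hε
    -- `K` bounds `μ(D ∩ s)` and is at least 1. Replacing `c` by the rational `q`, and `s` by a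
    -- member `t` of `S`, each costs at most `ε / 2`; the `1 + |q|` below avoids dividing by zero
    -- when `q = 0`.
    set K := μ.real Set.univ + |c| + 1
    have hK : 0 < K := by positivity
    obtain ⟨q, hq1, hq2⟩ := exists_rat_btwn (show c < c + ε / (2 * K) by
      linarith [div_pos hε (mul_pos two_pos hK)])
    have hq : |c - q| ≤ ε / (2 * K) := by rw [abs_le]; constructor <;> linarith
    obtain ⟨t, ht, hst⟩ := hdense.approx (m := MeasurableSpace.generateFrom S) s hs
      (measure_ne_top _ _) (ε / (4 * K) / (1 + |(q : ℝ)|)) (by positivity)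
    have ht' : MeasurableSet[MeasurableSpace.generateFrom S] t :=
      MeasurableSpace.measurableSet_generateFrom ht
    rw [trim_measurableSet_eq hm (hs.symmDiff ht')] at hst
    have hst' : μ.real (symmDiff s t) ≤ ε / (4 * K) / (1 + |(q : ℝ)|) :=
      ENNReal.toReal_le_of_le_ofReal (by positivity) hst.le
    refine ⟨1, fun _ => t, fun _ => q, fun _ => ht, fun D hD => ?_⟩
    rw [setIntegral_indicator (hm _ hs), setIntegral_const, smul_eq_mul]
    simp only [Finset.univ_unique, Finset.sum_const, Finset.card_singleton, one_smul]
    have h1 : |μ.real (D ∩ s) - μ.real (t ∩ D)| ≤ μ.real (symmDiff s t) := by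
      refine (abs_measureReal_sub_le_measureReal_symmDiff'
        (hD.inter (hm _ hs)).nullMeasurableSet ((hm _ ht').inter hD).nullMeasurableSet
        (measure_ne_top _ _) (measure_ne_top _ _)).trans ?_
      refine measureReal_mono fun x hx => ?_
      simp only [Set.mem_symmDiff, Set.mem_inter_iff] at hx ⊢
      tauto
    have h2 : μ.real (D ∩ s) ≤ K := by
      have := measureReal_mono (μ := μ) (Set.subset_univ (D ∩ s))
      have := abs_nonneg c
      simp only [K]; linarith
    have e : μ.real (D ∩ s) * c - q * μ.real (t ∩ D) =
        μ.real (D ∩ s) * (c - q) + q * (μ.real (D ∩ s) - μ.real (t ∩ D)) := by ring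
    rw [e]
    refine (abs_add_le _ _).trans ?_
    rw [abs_mul, abs_mul, abs_of_nonneg (measureReal_nonneg (μ := μ))]
    have h3 : μ.real (D ∩ s) * |c - q| ≤ ε / 2 := by
      calc _ ≤ K * (ε / (2 * K)) := by gcongr
        _ = ε / 2 := by field_simp
    have h4 : |(q : ℝ)| * |μ.real (D ∩ s) - μ.real (t ∩ D)| ≤ ε / 2 := by
      have hK1 : 1 ≤ K := by
        have : 0 ≤ μ.real Set.univ := measureReal_nonneg
        have := abs_nonneg c
        simp only [K]; linarith
      calc _ ≤ (1 + |(q : ℝ)|) * (ε / (4 * K) / (1 + |(q : ℝ)|)) := by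
            gcongr
            · linarith
            · exact h1.trans hst'
        _ = ε / (4 * K) := by field_simp
        _ ≤ ε / 2 := by gcongr; linarith
    linarith
  have hadd : ∀ {f g : Ω → ℝ}, Integrable f μ → Integrable g μ → P f → P g → P (f + g) := by
    intro f g hfi hgi hf hg ε hε
    obtain ⟨k, H, β, hH, h⟩ := hf (ε / 2) (half_pos hε)
    obtain ⟨k', H', β', hH', h'⟩ := hg (ε / 2) (half_pos hε)
    refine ⟨k + k', Fin.append H H', Fin.append β β', fun j => ?_, fun D hD => ?_⟩
    · refine Fin.addCases (fun j => ?_) (fun j => ?_) j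
      · simpa using hH j
      · simpa using hH' j
    · simp only [Pi.add_apply]
      rw [integral_add hfi.integrableOn hgi.integrableOn, Fin.sum_univ_add]
      simp only [Fin.append_left, Fin.append_right]
      rw [add_sub_add_comm]
      refine (abs_add_le _ _).trans ?_
      linarith [h D hD, h' D hD]
  have hmain : ∀ ⦃f : Ω → ℝ⦄, Integrable[MeasurableSpace.generateFrom S] f (μ.trim hm) → P f := by
    refine @Integrable.induction Ω ℝ (MeasurableSpace.generateFrom S) _ (μ.trim hm) P ?_ ?_ ?_ ?_
    · intro c s hs _
      exact hind c hs
    · intro f g _ hf hg hPf hPg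
      exact hadd (integrable_of_integrable_trim hm hf) (integrable_of_integrable_trim hm hg) hPf hPg
    · refine isClosed_of_closure_subset fun f hf => ?_
      have hfi := integrable_of_integrable_trim hm (L1.integrable_coeFn f)
      refine hlim f hfi fun δ hδ => ?_
      obtain ⟨g, hg, hfg⟩ := Metric.mem_closure_iff.1 hf δ hδ
      have hgi := integrable_of_integrable_trim hm (L1.integrable_coeFn g)
      refine ⟨g, hg, hgi, ?_⟩
      rw [L1.dist_eq_integral_dist] at hfg
      have hsm : StronglyMeasurable[MeasurableSpace.generateFrom S] fun x => ‖f x - g x‖ :=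
        ((Lp.stronglyMeasurable f).sub (Lp.stronglyMeasurable g)).norm
      rw [integral_trim hm hsm]
      simpa only [dist_eq_norm] using hfg.le
    · intro f g hfg _ hf
      exact hcongr (ae_eq_of_ae_eq_trim hfg) hf
  -- Integrability for the trimmed measure needs a version of `g` that is genuinely measurable for
  -- the small σ-algebra.
  refine hcongr hg.ae_eq_mk.symm (hmain ?_) ε hε
  exact (hgi.congr hg.ae_eq_mk).trim hm hg.stronglyMeasurable_mk

/-- If every measure inequality between members of `S₁` and a member of `S₀` is almost realized by
a member of `S`, then conditioning `S₁`-measurable functions on `S` or on `S₀` is the same. -/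
theorem condExp_ae_eq_of_realizable {Ω : Type*} {m0 : MeasurableSpace Ω} (μ : Measure Ω)
    [IsFiniteMeasure μ] {S S₀ S₁ : Set (Set Ω)} (hS₀ : IsSetAlgebra S₀) (hS₁ : IsSetAlgebra S₁)
    (h0 : S ⊆ S₀) (h1 : S ⊆ S₁)
    (hm₀ : MeasurableSpace.generateFrom S₀ ≤ m0) (hm₁ : MeasurableSpace.generateFrom S₁ ≤ m0)
    (key : ∀ (k : ℕ) (H : Fin k → Set Ω) (β : Fin k → ℚ) (γ : ℚ) (D : Set Ω), (∀ j, H j ∈ S₁) →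
      D ∈ S₀ → γ < ∑ j, (β j : ℝ) * μ.real (H j ∩ D) →
      ∃ D' ∈ S, γ ≤ ∑ j, (β j : ℝ) * μ.real (H j ∩ D'))
    {f : Ω → ℝ} (hf : AEStronglyMeasurable[MeasurableSpace.generateFrom S₁] f μ)
    (hfi : Integrable f μ) :
    μ[f | MeasurableSpace.generateFrom S] =ᵐ[μ] μ[f | MeasurableSpace.generateFrom S₀] := by
  have hle0 : MeasurableSpace.generateFrom S ≤ MeasurableSpace.generateFrom S₀ :=
    MeasurableSpace.generateFrom_mono h0
  have hle1 : MeasurableSpace.generateFrom S ≤ MeasurableSpace.generateFrom S₁ :=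
    MeasurableSpace.generateFrom_mono h1
  have hm := hle0.trans hm₀
  set h := μ[f | MeasurableSpace.generateFrom S] with hh
  have hhi : Integrable h μ := integrable_condExp
  have hhm : StronglyMeasurable[MeasurableSpace.generateFrom S] h := stronglyMeasurable_condExp
  have hgi : Integrable (f - h) μ := hfi.sub hhi
  have hgm : AEStronglyMeasurable[MeasurableSpace.generateFrom S₁] (f - h) μ :=
    hf.sub (hhm.mono hle1).aestronglyMeasurable
  have hzero : ∀ D, MeasurableSet[MeasurableSpace.generateFrom S] D →
      ∫ x in D, (f - h) x ∂μ = 0 := by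
    intro D hD
    simp only [Pi.sub_apply]
    rw [integral_sub hfi.integrableOn hhi.integrableOn, hh, setIntegral_condExp hm hfi hD, sub_self]
  have hnonpos : ∀ D ∈ S₀, ∫ x in D, (f - h) x ∂μ ≤ 0 := by
    intro D hD
    by_contra! hδ
    set δ := ∫ x in D, (f - h) x ∂μ
    obtain ⟨k, H, β, hH, happ⟩ :=
      -- With error `δ / 5`, the combination is at least `4δ / 5 > γ` on `D`, but at most `δ / 5 <
      -- γ` on any `D' ∈ S`, where `f - h` integrates to zero.
      exists_rat_combination μ hS₁ hm₁ hgm hgi (show 0 < δ / 5 by linarith)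
    obtain ⟨γ, hγ1, hγ2⟩ := exists_rat_btwn (show δ / 5 < 4 * δ / 5 by linarith)
    have hD' := (abs_le.1 (happ D (hm₀ _ (MeasurableSpace.measurableSet_generateFrom hD)))).2
    obtain ⟨D', hD'S, hle⟩ := key k H β γ D hH hD (by linarith)
    have hmD' := MeasurableSpace.measurableSet_generateFrom hD'S
    have := (abs_le.1 (happ D' (hm _ hmD'))).1
    rw [hzero D' hmD'] at this
    linarith
  have huniv : ∫ x, (f - h) x ∂μ = 0 := by
    have := hzero Set.univ MeasurableSet.univ
    rwa [setIntegral_univ] at this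
  have hz0 : ∀ D ∈ S₀, ∫ x in D, (f - h) x ∂μ = 0 := by
    intro D hD
    refine le_antisymm (hnonpos D hD) ?_
    -- The integrals over `D` and its complement are both nonpositive and sum to zero.
    have h2 := hnonpos _ (hS₀.compl_mem hD)
    have h3 := integral_add_compl (hm₀ _ (MeasurableSpace.measurableSet_generateFrom hD)) hgi
    linarith
  have hpi : IsPiSystem S₀ := fun s hs t ht _ => hS₀.inter_mem hs ht
  have hall : ∀ D, MeasurableSet[MeasurableSpace.generateFrom S₀] D →
      ∫ x in D, (f - h) x ∂μ = 0 := by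
    refine MeasurableSpace.induction_on_inter (m := MeasurableSpace.generateFrom S₀)
      (C := fun D _ => ∫ x in D, (f - h) x ∂μ = 0) rfl hpi ?_ hz0 ?_ ?_
    · simp
    · intro t ht h2
      have h3 := integral_add_compl (hm₀ _ ht) hgi
      linarith
    · intro F hF hFm h2
      rw [integral_iUnion (fun i => hm₀ _ (hFm i)) hF hgi.integrableOn]
      simp only [h2, tsum_zero]
  refine ae_eq_condExp_of_forall_setIntegral_eq hm₀ hfi (fun s _ _ => hhi.integrableOn) ?_
    (hhm.mono hle0).aestronglyMeasurable
  intro D hD _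
  have := hall D hD
  simp only [Pi.sub_apply] at this
  rw [integral_sub hfi.integrableOn hhi.integrableOn] at this
  linarith

/-! ### Internal sets, saturation and the Loeb measure. -/

section Loeb

variable {ι : Type w} (U : Ultrafilter ι) {G : ι → Type w'}

/-- Membership does not depend on the representatives that `coord` picks, because any two agree in
almost every factor. -/
theorem mem_internalSet_coe {n : ℕ} (S : ∀ i, Set (Fin n → G i)) (r : ∀ i, Fin n → G i) :
    (fun j => ((fun i => r i j : ∀ i, G i) : UProd U G)) ∈ internalSet U S ↔
      ∀ᶠ i in (U : Filter ι), r i ∈ S i := by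
  refine eventually_congr ?_
  filter_upwards [coord_coe U (G := G) fun j i => r i j] with i hi
  rw [hi]

/-- If the inclusion fails in almost every factor, witnesses chosen coordinatewise form a point of
the ultraproduct violating it. Hence `internalCount` depends only on the internal set, as
`internalContent_internalSet` needs. -/
theorem internalSet_subset_iff {n : ℕ} [∀ i, Nonempty (G i)] {S T : ∀ i, Set (Fin n → G i)} :
    internalSet U S ⊆ internalSet U T ↔ ∀ᶠ i in (U : Filter ι), S i ⊆ T i := by
  refine ⟨fun h => ?_, fun h p hp => ?_⟩
  · by_contra hc
    rw [← Ultrafilter.eventually_not] at hc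
    let r : ∀ i, Fin n → G i := fun i => Classical.epsilon fun x => x ∈ S i ∧ x ∉ T i
    have hr : ∀ᶠ i in (U : Filter ι), r i ∈ S i ∧ r i ∉ T i := by
      filter_upwards [hc] with i hi
      exact Classical.epsilon_spec (Set.not_subset.1 hi)
    have := (mem_internalSet_coe U T r).1
      (h ((mem_internalSet_coe U S r).2 (hr.mono fun i hi => hi.1)))
    exact Ultrafilter.eventually_not.1 (hr.mono fun i hi => hi.2) this
  · filter_upwards [h, hp] with i hi hpi
    exact hi hpi

theorem internalCount_mono {n : ℕ} [∀ i, Finite (G i)] {S T : ∀ i, Set (Fin n → G i)}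
    (h : ∀ᶠ i in (U : Filter ι), S i ⊆ T i) : internalCount U S ≤ internalCount U T := by
  refine le_of_tendsto_of_tendsto (tendsto_internalCount U S) (tendsto_internalCount U T) ?_
  filter_upwards [h] with i hi
  gcongr
  exact Set.toFinite _

theorem internalContent_internalSet {n : ℕ} [∀ i, Finite (G i)] [∀ i, Nonempty (G i)]
    (S : ∀ i, Set (Fin n → G i)) : internalContent U (internalSet U S) = internalCount U S := by
  refine le_antisymm (iInf_le_of_le S (iInf_le _ rfl)) (le_iInf₂ fun T hT => ?_)
  exact internalCount_mono U ((internalSet_subset_iff U).1 hT.subset)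

/-- **Countable saturation** of the ultraproduct, for coverings by internal sets. -/
theorem internalSet_subset_biUnion {n : ℕ} [∀ i, Nonempty (G i)] (e : ι → ℕ)
    (he : ∀ N, ∀ᶠ i in (U : Filter ι), N ≤ e i) (S : ∀ i, Set (Fin n → G i))
    (T : ℕ → ∀ i, Set (Fin n → G i)) (h : internalSet U S ⊆ ⋃ k, internalSet U (T k)) :
    ∃ N, ∀ᶠ i in (U : Filter ι), S i ⊆ ⋃ k ∈ Finset.range N, T k i := by
  classical
  by_contra! hc
  have hc' : ∀ N, ∀ᶠ i in (U : Filter ι), ∃ x, x ∈ S i ∧ ∀ k < N, x ∉ T k i := by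
    intro N
    filter_upwards [hc N] with i hi
    obtain ⟨x, hx, hx'⟩ := Set.not_subset.1 hi
    exact ⟨x, hx, fun k hk hxk =>
      hx' (Set.mem_biUnion (Finset.mem_coe.2 (Finset.mem_range.2 hk)) hxk)⟩
  -- Diagonal choice: in factor `i`, avoid as many of the first `e i` sets as possible. As `e` tends
  -- to infinity along `U`, so does `N`, and the resulting point avoids every `internalSet U (T k)`.
  let N : ι → ℕ := fun i => Nat.findGreatest (fun N => ∃ x, x ∈ S i ∧ ∀ k < N, x ∉ T k i) (e i)
  let r : ∀ i, Fin n → G i := fun i => Classical.epsilon fun x => x ∈ S i ∧ ∀ k < N i, x ∉ T k i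
  have hr : ∀ m, ∀ᶠ i in (U : Filter ι), r i ∈ S i ∧ ∀ k < m, r i ∉ T k i := by
    intro m
    filter_upwards [hc' m, he m] with i hi hei
    have h1 : ∃ x, x ∈ S i ∧ ∀ k < N i, x ∉ T k i :=
      Nat.findGreatest_spec (P := fun N => ∃ x, x ∈ S i ∧ ∀ k < N, x ∉ T k i) hei hi
    have h2 : m ≤ N i := Nat.le_findGreatest hei hi
    have h3 : r i ∈ S i ∧ ∀ k < N i, r i ∉ T k i := Classical.epsilon_spec h1
    exact ⟨h3.1, fun k hk => h3.2 k (hk.trans_le h2)⟩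
  obtain ⟨k, hk⟩ := Set.mem_iUnion.1
    (h ((mem_internalSet_coe U S r).2 ((hr 0).mono fun i hi => hi.1)))
  replace hk := (mem_internalSet_coe U (T k) r).1 hk
  exact Ultrafilter.eventually_not.1 ((hr (k + 1)).mono fun i hi => hi.2 k k.lt_succ_self) hk

theorem internalCount_biUnion_le {n : ℕ} [∀ i, Finite (G i)] (T : ℕ → ∀ i, Set (Fin n → G i))
    (N : ℕ) : internalCount U (fun i => ⋃ k ∈ Finset.range N, T k i) ≤
      ∑ k ∈ Finset.range N, internalCount U (T k) := by
  refine le_of_tendsto_of_tendsto' (tendsto_internalCount U _)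
    (tendsto_finsetSum _ fun k _ => tendsto_internalCount U (T k)) fun i => ?_
  simp only [div_eq_mul_inv]
  rw [← Finset.sum_mul, ← Nat.cast_sum]
  gcongr
  exact Finset.set_ncard_biUnion_le _ _

/-- The Loeb measure of an internal set is the standard part of its normalized cardinality. -/
theorem loebMeasure_internalSet {n : ℕ} [∀ i, Finite (G i)] [∀ i, Nonempty (G i)] (e : ι → ℕ)
    (he : ∀ N, ∀ᶠ i in (U : Filter ι), N ≤ e i) (S : ∀ i, Set (Fin n → G i)) :
    loebMeasure U G n (internalSet U S) = internalCount U S := by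
  refine (toMeasure_apply (ms := loebSpace U G n) _ (loebSpace_le_caratheodory U G n)
    (MeasurableSpace.measurableSet_generateFrom ⟨S, rfl⟩)).trans ?_
  refine le_antisymm ((OuterMeasure.ofFunction_le _).trans
    (internalContent_internalSet U S).le) ?_
  rw [OuterMeasure.ofFunction_apply]
  refine le_iInf₂ fun t ht => ?_
  -- A countable cover with a non-internal piece costs `∞`. A cover by internal sets reduces by
  -- saturation to a finite one, where counting is subadditive.
  by_cases hint : ∀ k, ∃ T : ∀ i, Set (Fin n → G i), t k = internalSet U T
  · choose T hT using hint
    obtain rfl : t = fun k => internalSet U (T k) := funext hT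
    obtain ⟨N, hN⟩ := internalSet_subset_biUnion U e he S T ht
    refine (internalCount_mono U hN).trans ((internalCount_biUnion_le U T N).trans ?_)
    simp only [internalContent_internalSet]
    exact ENNReal.sum_le_tsum _
  · push Not at hint
    obtain ⟨k, hk⟩ := hint
    have : internalContent U (t k) = ∞ := by
      simp only [internalContent, iInf_eq_top]
      exact fun T hT => absurd hT (hk T)
    exact le_top.trans (this ▸ ENNReal.le_tsum k)

theorem internalCount_le_one {n : ℕ} [∀ i, Finite (G i)]
    (S : ∀ i, Set (Fin n → G i)) : internalCount U S ≤ 1 := by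
  refine le_of_tendsto' (tendsto_internalCount U S) fun i => ?_
  refine ENNReal.div_le_of_le_mul ?_
  rw [one_mul, ← Nat.cast_pow]
  refine Nat.cast_le.2 ((Set.ncard_le_card (S i)).trans_eq ?_)
  simp [Nat.card_fun]

theorem isFiniteMeasure_loebMeasure {n : ℕ} [∀ i, Finite (G i)] [∀ i, Nonempty (G i)] (e : ι → ℕ)
    (he : ∀ N, ∀ᶠ i in (U : Filter ι), N ≤ e i) : IsFiniteMeasure (loebMeasure U G n) := by
  have hu : (Set.univ : Set (Fin n → UProd U G)) = internalSet U fun _ => Set.univ := by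
    ext p
    simp [internalSet]
  refine ⟨?_⟩
  rw [hu, loebMeasure_internalSet U e he]
  exact (internalCount_le_one U _).trans_lt ENNReal.one_lt_top

theorem tendsto_loebMeasure_real {n : ℕ} [∀ i, Finite (G i)] [∀ i, Nonempty (G i)] (e : ι → ℕ)
    (he : ∀ N, ∀ᶠ i in (U : Filter ι), N ≤ e i) (S : ∀ i, Set (Fin n → G i)) :
    Tendsto (fun i => ((S i).ncard : ℝ) / (Nat.card (G i) : ℝ) ^ n) (U : Filter ι)
      (nhds ((loebMeasure U G n).real (internalSet U S))) := by
  rw [Measure.real, loebMeasure_internalSet U e he]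
  have hne : internalCount U S ≠ ∞ :=
    ((internalCount_le_one U S).trans_lt ENNReal.one_lt_top).ne
  refine ((ENNReal.tendsto_toReal hne).comp (tendsto_internalCount U S)).congr fun i => ?_
  simp

end Loeb

/-! ### Syntax: renaming of variables and the Tarski–Vaught property. -/

section Logic

variable {L : FirstOrder.Language.{u, v}}

/-- Renaming of the free variables of a formula. -/
def Fml.relabel : {n : ℕ} → Fml L n → {m : ℕ} → (Fin n → Fin m) → Fml L m
  | _, .falsum, _, _ => .falsum
  | _, .equal t s, _, g => .equal (t.relabel g) (s.relabel g)
  | _, .rel R ts, _, g => .rel R fun i => (ts i).relabel g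
  | _, .imp φ ψ, _, g => .imp (φ.relabel g) (ψ.relabel g)
  | _, .all φ, m, g => .all (φ.relabel (Fin.snoc (fun i => (g i).castSucc) (Fin.last m)))
  | _, .integral j k α B γ, m, g =>
      .integral j k α
        (fun i => (B i).relabel (Fin.append (fun t => Fin.castAdd j (g t)) (Fin.natAdd m))) γ

/-- Under a binder, renaming fixes the bound variables; this and `append_comp_append` settle the
quantifier and integral cases of `Fml.finRealize_relabel`. -/
theorem snoc_comp_snoc {X : Type*} {n m : ℕ} (g : Fin n → Fin m) (p : Fin m → X) (x : X) :
    (Fin.snoc p x : Fin (m + 1) → X) ∘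
      (Fin.snoc (fun i => (g i).castSucc) (Fin.last m) : Fin (n + 1) → Fin (m + 1)) =
      Fin.snoc (p ∘ g) x := by
  funext i
  refine Fin.lastCases ?_ (fun i => ?_) i <;> simp

theorem append_comp_append {X : Type*} {n m j : ℕ} (g : Fin n → Fin m) (p : Fin m → X)
    (x : Fin j → X) :
    Fin.append p x ∘ Fin.append (fun t => Fin.castAdd j (g t)) (Fin.natAdd m) =
      Fin.append (p ∘ g) x := by
  funext i
  refine Fin.addCases (fun i => ?_) (fun i => ?_) i <;> simp

theorem Fml.finRealize_relabel {X : Type w} [L.Structure X] {n : ℕ} (φ : Fml L n) {m : ℕ}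
    (g : Fin n → Fin m) (p : Fin m → X) :
    (φ.relabel g).FinRealize p ↔ φ.FinRealize (p ∘ g) := by
  induction φ generalizing m with
  | falsum => rfl
  | equal t s => simp [relabel, FinRealize]
  | rel R ts => simp [relabel, FinRealize]
  | imp φ ψ ih ih' => simp only [relabel, FinRealize, ih, ih']
  | all φ ih => simp only [relabel, FinRealize, ih, snoc_comp_snoc]
  | integral j k α B γ ih => simp only [relabel, FinRealize, ih, append_comp_append]

/-- Negation. -/
def Fml.not {n : ℕ} (φ : Fml L n) : Fml L n := .imp φ .falsum

/-- Conjunction. -/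
def Fml.and {n : ℕ} (φ ψ : Fml L n) : Fml L n := .not (.imp φ ψ.not)

theorem Fml.finRealize_and {X : Type w} [L.Structure X] {n : ℕ} (φ ψ : Fml L n) (p : Fin n → X) :
    (φ.and ψ).FinRealize p ↔ φ.FinRealize p ∧ ψ.FinRealize p := by
  simp [Fml.and, Fml.not, FinRealize]

/-- Universal quantification over the last `l` variables. -/
def Fml.alls {n : ℕ} : (l : ℕ) → Fml L (n + l) → Fml L n
  | 0, φ => φ
  | l + 1, φ => Fml.alls l (.all φ)

theorem Fml.realize_alls {X : Type w} [L.Structure X] (I : IntegralInterp L X) {n l : ℕ}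
    (φ : Fml L (n + l)) (p : Fin n → X) :
    (φ.alls l).Realize I p ↔ ∀ y : Fin l → X, φ.Realize I (Fin.append p y) := by
  induction l with
  | zero =>
    refine ⟨fun h y => ?_, fun h => ?_⟩
    · rw [Subsingleton.elim y Fin.elim0, Fin.append_elim0]
      exact h
    · have := h Fin.elim0
      rwa [Fin.append_elim0] at this
  | succ l ih =>
    simp only [alls, ih, Realize]
    refine ⟨fun h y => ?_, fun h y x => ?_⟩
    · rw [← Fin.snoc_init_self y, Fin.append_snoc]
      exact h _ _
    · rw [← Fin.append_snoc]
      exact h _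

/-- The Tarski–Vaught property of elementary substructures. -/
theorem IsElementary.exists_realize {X : Type w} [L.Structure X] {I : IntegralInterp L X}
    {M : L.Substructure X} (hM : IsElementary I M) {n l : ℕ} (φ : Fml L (n + l)) (m : Fin n → X)
    (hm : ∀ i, m i ∈ M) (a : Fin l → X) (h : φ.Realize I (Fin.append m a)) :
    ∃ b : Fin l → X, (∀ i, b i ∈ M) ∧ φ.Realize I (Fin.append m b) := by
  by_contra! hc
  -- If no `b` in `M` worked, `∀ y, ¬ φ(m, y)` would hold in `M`, hence in `X`, contradicting `a`.
  have h1 := (hM (φ.not.alls l) fun i => ⟨m i, hm i⟩).1 ((Fml.realize_alls _ _ _).2 fun y hy => by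
    refine hc (fun i => y i) (fun i => (y i).2) ?_
    have h2 := (hM φ _).1 hy
    convert h2 using 1
    funext i
    refine Fin.addCases (fun i => ?_) (fun i => ?_) i <;> simp)
  exact (Fml.realize_alls _ _ _).1 h1 a h

end Logic

/-! ### Measure inequalities between definable sets as integral formulas. -/

section Definable

variable {ι : Type w} (U : Ultrafilter ι) {G : ι → Type w'} {L : FirstOrder.Language.{u, v}}

theorem coord_append {n m : ℕ} (p : Fin n → UProd U G) (q : Fin m → UProd U G) (i : ι) :
    coord (Fin.append p q) i = Fin.append (coord p i) (coord q i) := by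
  funext j
  refine Fin.addCases (fun j => ?_) (fun j => ?_) j <;> simp [coord]

variable [∀ i, L.Structure (G i)] [∀ i, Nonempty (G i)]

theorem realize_iff_coord {n : ℕ} (φ : Fml L n) (p : Fin n → UProd U G) :
    φ.Realize (ultraInterp U G L) p ↔ ∀ᶠ i in (U : Filter ι), φ.FinRealize (coord p i) := by
  rw [show p = fun j => ((Quotient.out (p j) : ∀ i, G i) : UProd U G) from
    funext fun j => (Quotient.out_eq _).symm, realize_coe]
  refine eventually_congr ?_
  filter_upwards [coord_coe U fun j => Quotient.out (p j)] with i hi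
  rw [hi]

theorem ParamFml.toSet_eq_internalSet {n : ℕ} (θ : ParamFml L (UProd U G) n) :
    θ.toSet (ultraInterp U G L) =
      internalSet U fun i => {x | θ.fml.FinRealize (Fin.append x (coord θ.param i))} := by
  ext p
  simp only [ParamFml.toSet, internalSet, Set.mem_ofPred_eq, realize_iff_coord, coord_append]

/-- Measure inequalities between definable sets with parameters in an elementary substructure `M`
and one definable set `φ(x, a)` are almost realized by some `φ(x, b)` with `b` in `M`. -/
theorem exists_param_le_sum_loebMeasure [∀ i, Finite (G i)] (e : ι → ℕ)
    (he : ∀ N, ∀ᶠ i in (U : Filter ι), N ≤ e i) {M : L.Substructure (UProd U G)}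
    (hM : IsElementary (ultraInterp U G L) M) {n k : ℕ} (θ : Fin k → ParamFml L (UProd U G) n)
    (hθ : ∀ j i, (θ j).param i ∈ M) (β : Fin k → ℚ) (γ : ℚ) (η : ParamFml L (UProd U G) n)
    (h : γ < ∑ j, (β j : ℝ) * (loebMeasure U G n).real
      ((θ j).toSet (ultraInterp U G L) ∩ η.toSet (ultraInterp U G L))) :
    ∃ b : Fin η.len → UProd U G, (∀ i, b i ∈ M) ∧
      γ ≤ ∑ j, (β j : ℝ) * (loebMeasure U G n).real ((θ j).toSet (ultraInterp U G L) ∩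
        (⟨η.len, η.fml, b⟩ : ParamFml L (UProd U G) n).toSet (ultraInterp U G L)) := by
  -- The parameters of all the `θ j` are concatenated into one tuple `m` from `M`.
  let N := ∑ j, (θ j).len
  let m : Fin N → UProd U G := fun t =>
    (θ (finSigmaFinEquiv.symm t).1).param (finSigmaFinEquiv.symm t).2
  have hmθ : ∀ j t, m (finSigmaFinEquiv ⟨j, t⟩) = (θ j).param t := fun j t =>
    congrArg (fun s : (j : Fin k) × Fin (θ j).len => (θ s.1).param s.2)
      (finSigmaFinEquiv.symm_apply_apply ⟨j, t⟩)
  -- A `ParamFml` lists `x` first, whereas an integral binds the last variables. The renamings pass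
  -- to the order `m`, `y`, `x`, with `y` standing for the parameters of `η`.
  let r : ∀ j, Fin (n + (θ j).len) → Fin (N + η.len + n) := fun j =>
    Fin.append (Fin.natAdd (N + η.len))
      (fun t => Fin.castAdd n (Fin.castAdd η.len (finSigmaFinEquiv ⟨j, t⟩)))
  let r' : Fin (n + η.len) → Fin (N + η.len + n) :=
    Fin.append (Fin.natAdd (N + η.len)) (fun t => Fin.castAdd n (Fin.natAdd N t))
  let ψ : Fml L (N + η.len) :=
    .integral n k β (fun j => ((θ j).fml.relabel (r j)).and (η.fml.relabel r')) γ
  let S : (Fin η.len → UProd U G) → Fin k → ∀ i, Set (Fin n → G i) := fun b j i =>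
    {x | (θ j).fml.FinRealize (Fin.append x (coord (θ j).param i)) ∧
      η.fml.FinRealize (Fin.append x (coord b i))}
  have hψ : ∀ b : Fin η.len → UProd U G, ψ.Realize (ultraInterp U G L) (Fin.append m b) ↔
      ∀ᶠ i in (U : Filter ι), (γ : ℝ) <
        ∑ j, (β j : ℝ) * (((S b j i).ncard : ℝ) / (Nat.card (G i) : ℝ) ^ n) := by
    intro b
    simp only [ψ, Fml.Realize, ultraInterp, coord_append]
    refine eventually_congr (Eventually.of_forall fun i => ?_)
    have e1 : ∀ j (x : Fin n → G i), Fin.append (Fin.append (coord m i) (coord b i)) x ∘ r j =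
        Fin.append x (coord (θ j).param i) := by
      intro j x
      funext t
      refine Fin.addCases (fun t => ?_) (fun t => ?_) t
      · simp [r]
      · simp [r, coord, hmθ]
    have e2 : ∀ x : Fin n → G i, Fin.append (Fin.append (coord m i) (coord b i)) x ∘ r' =
        Fin.append x (coord b i) := by
      intro x
      funext t
      refine Fin.addCases (fun t => ?_) (fun t => ?_) t <;> simp [r']
    simp only [Fml.FinRealize, Fml.finRealize_and, Fml.finRealize_relabel, e1, e2, S]
    rw [← Rat.cast_lt (K := ℝ)]
    push_cast
    exact Iff.rfl
  have hlim : ∀ b : Fin η.len → UProd U G, Tendsto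
      (fun i => ∑ j, (β j : ℝ) * (((S b j i).ncard : ℝ) / (Nat.card (G i) : ℝ) ^ n)) (U : Filter ι)
      (nhds (∑ j, (β j : ℝ) * (loebMeasure U G n).real ((θ j).toSet (ultraInterp U G L) ∩
        (⟨η.len, η.fml, b⟩ : ParamFml L (UProd U G) n).toSet (ultraInterp U G L)))) := by
    intro b
    refine tendsto_finsetSum _ fun j _ => Tendsto.const_mul _ ?_
    have e3 : (θ j).toSet (ultraInterp U G L) ∩
        (⟨η.len, η.fml, b⟩ : ParamFml L (UProd U G) n).toSet (ultraInterp U G L) =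
        internalSet U (S b j) := by
      simp only [ParamFml.toSet_eq_internalSet]
      ext p
      simp [internalSet, eventually_and, S]
    rw [e3]
    exact tendsto_loebMeasure_real U e he _
  obtain ⟨b, hb, hbψ⟩ := hM.exists_realize ψ m (fun t => hθ _ _) η.param
    ((hψ _).2 ((hlim _).eventually_const_lt h))
  -- A strict inequality for the limit holds in almost every factor, which gave `ψ` at `η.param`;
  -- back from the factors to the limit only `≤` survives.
  exact ⟨b, hb, ge_of_tendsto (hlim b) (((hψ b).1 hbψ).mono fun i hi => hi.le)⟩

end Definable

/-! ### The lemma for the ultraproduct of cyclic groups. -/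

instance (A : ∀ n : ℕ, Set (ZMod (2 * n + 1))) (n : PrimeIdx) : Nonempty (Cyc A n) := ⟨0⟩

end IntLogic

theorem mainTheorem3
    (A : ∀ n : ℕ, Set (ZMod (2 * n + 1)))
    (U : Ultrafilter PrimeIdx) (hU : (U : Filter PrimeIdx) ≤ Filter.cofinite)
    (n : ℕ) (𝓑 𝓑₀ 𝓑₁ : FmlAlgebra (ugroupInterp A U) n)
    (hsub : 𝓑.sets ⊆ 𝓑₀.sets ∩ 𝓑₁.sets)
    (M : groupPred.Substructure (UGroup A U)) (hM : IsElementary (ugroupInterp A U) M)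
    (hparam : ∀ θ ∈ 𝓑₁.formulas, ∀ i, θ.param i ∈ M)
    (hsubst : ∀ θ ∈ 𝓑₀.formulas, ∀ b : Fin θ.len → UGroup A U, (∀ i, b i ∈ M) →
      (⟨θ.len, θ.fml, b⟩ : ParamFml groupPred (UGroup A U) n).toSet (ugroupInterp A U) ∈ 𝓑.sets)
    (f : (Fin n → UGroup A U) → ℝ)
    (hf : AEStronglyMeasurable[𝓑₁.sigma] f (loebMeasure U (Cyc A) n))
    (hf2 : MemLp f 2 (loebMeasure U (Cyc A) n)) :
    eLpNorm ((loebMeasure U (Cyc A) n)[f | 𝓑.sigma] - (loebMeasure U (Cyc A) n)[f | 𝓑₀.sigma]) 2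
      (loebMeasure U (Cyc A) n) = 0 := by
  -- Nonprincipality makes the index itself tend to infinity along `U`, which supplies the function
  -- `e` needed for saturation.
  have he : ∀ N, ∀ᶠ i in (U : Filter PrimeIdx), N ≤ i.1 := by
    intro N
    refine hU ?_
    rw [Filter.mem_cofinite]
    refine ((Set.finite_lt_nat N).preimage Subtype.val_injective.injOn).subset fun i hi => ?_
    simpa using hi
  have := isFiniteMeasure_loebMeasure U (G := Cyc A) (n := n) (fun i => i.1) he
  have hae := condExp_ae_eq_of_realizable (loebMeasure U (Cyc A) n)
    (S := 𝓑.sets) (S₀ := 𝓑₀.sets) (S₁ := 𝓑₁.sets) 𝓑₀.isSetAlgebra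
    𝓑₁.isSetAlgebra (fun s hs => (hsub hs).1) (fun s hs => (hsub hs).2)
    (FmlAlgebra.sigma_le U (Cyc A) 𝓑₀) (FmlAlgebra.sigma_le U (Cyc A) 𝓑₁) ?_ hf
    (hf2.integrable (by norm_num))
  · exact (eLpNorm_congr_ae hae.sub_eq).trans eLpNorm_zero
  · rintro k H β γ D hH ⟨η, hη, rfl⟩ hγ
    choose θ hθ hθH using hH
    obtain rfl : (fun j => (θ j).toSet (ugroupInterp A U)) = H := funext hθH
    -- Condition 1 puts the parameters of the `θ j` in `M`; condition 2 then puts the set `φ(x, b)`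
    -- obtained here in `𝓑`.
    obtain ⟨b, hb, hle⟩ := exists_param_le_sum_loebMeasure U (fun i => i.1) he hM θ
      (fun j => hparam _ (hθ j)) β γ η hγ
    exact ⟨_, hsubst η hη b hb, hle⟩
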